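/- Consider the space $\mathbb N^{\mathbb N\times\mathbb N}\times\mathbb N^{\mathbb N}\times\mathbb N$ with the product topology ($\mathbb N$ discrete), and let $\mathcal G_{\mathrm{tf}}$ be its subspace of all triples (multiplication, inversion, identity) that make $\mathbb N$ into a torsion-free group, i.e. a group in which no non-trivial element has finite order. A property of groups is said to hold for a generic countable torsion-free group if it holds for all groups in a comeager subset of $\mathcal G_{\mathrm{tf}}$, i.e. in a subset containing a countable intersection of dense open subsets of $\mathcal G_{\mathrm{tf}}$. For a group $G$ write $[x,y]=x^{-1}y^{-1}xy$, and let $C_G(A)$ be the centralizer of $A\subseteq G$. An element $g\in G$ is algebraically disjoint from $f\in G$ if for every $h\in G$ with $[f,h]\neq 1$ there are $a,b\in C_G(g)$ such that $1\neq [a,[b,h]]\in C_G(g)$. For $f\in G$ let $$S_f=\{g^{12} \mid g\in G \text{ algebraically disjoint from } f\}.$$ **Corollary 4.3.** A generic countable torsion-free group $G$ has the following properties. 1. $C_G(S_g)=\langle g\rangle$ for every non-trivial $g\in G$. 2. For all $n\geq 1$ and all $g_1,\dots,g_n\in G$, $$C_G(S_{g_1})\cap\cdots\cap C_G(S_{g_n})=\bigcap_{1\leq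 i\leq n}\langle g_i\rangle,$$ and this group is trivial or infinite cyclic. 3. $G$ is divisible: for every $x\in G$ and every integer $m\geq 1$ there is $y\in G$ with $y^m=x$. -/

import Mathlib

/-- The space `ℕ^(ℕ × ℕ) × ℕ^ℕ × ℕ` of triples (multiplication, inversion, identity) on `ℕ`,
with the product topology (`ℕ` is discrete). -/
abbrev OperationTriple : Type := (ℕ × ℕ → ℕ) × (ℕ → ℕ) × ℕ

/-- The group axioms for a triple (multiplication, inversion, identity) on `ℕ`. -/
structure IsGroupTriple (t : OperationTriple) : Prop where
  mul_assoc : ∀ x y z : ℕ, t.1 (t.1 (x, y), z) = t.1 (x, t.1 (y, z))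
  one_mul : ∀ x : ℕ, t.1 (t.2.2, x) = x
  mul_one : ∀ x : ℕ, t.1 (x, t.2.2) = x
  inv_mul_cancel : ∀ x : ℕ, t.1 (t.2.1 x, x) = t.2.2
  mul_inv_cancel : ∀ x : ℕ, t.1 (x, t.2.1 x) = t.2.2

/-- The space of enumerated countably infinite groups, with the subspace topology. -/
abbrev EnumeratedGroup : Type := {t : OperationTriple // IsGroupTriple t}

/-- The underlying set `ℕ` of an enumerated group, as a type that depends on the group. -/
def EnumeratedGroup.Carrier (_G : EnumeratedGroup) : Type := ℕ

instance EnumeratedGroup.instGroupCarrier (G : EnumeratedGroup) : Group G.Carrier where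
  mul x y := G.1.1 (x, y)
  one := G.1.2.2
  inv x := G.1.2.1 x
  mul_assoc := G.2.mul_assoc
  one_mul := G.2.one_mul
  mul_one := G.2.mul_one
  inv_mul_cancel := G.2.inv_mul_cancel

/-- The space of enumerated torsion-free groups (no non-trivial element has finite order), with
the subspace topology. -/
abbrev TorsionFreeEnumeratedGroup : Type :=
  {G : EnumeratedGroup // ∀ x : G.Carrier, x ≠ 1 → ¬ IsOfFinOrder x}

/-- The commutator `[x, y] = x⁻¹ y⁻¹ x y`. -/
def groupComm {G : Type*} [Group G] (x y : G) : G := x⁻¹ * y⁻¹ * x * y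

/-- `g` is algebraically disjoint from `f`: whenever `[f, h] ≠ 1` there are `a, b` in the
centralizer of `g` such that `[a, [b, h]]` is non-trivial and centralizes `g`. -/
def AlgebraicallyDisjoint {G : Type*} [Group G] (g f : G) : Prop :=
  ∀ h : G, groupComm f h ≠ 1 →
    ∃ a ∈ Subgroup.centralizer ({g} : Set G), ∃ b ∈ Subgroup.centralizer ({g} : Set G),
      groupComm a (groupComm b h) ≠ 1 ∧
        groupComm a (groupComm b h) ∈ Subgroup.centralizer ({g} : Set G)

/-- `S_f`, the set of the twelfth powers of the elements algebraically disjoint from `f`. -/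
def rubinSet {G : Type*} [Group G] (f : G) : Set G :=
  {x | ∃ g : G, AlgebraicallyDisjoint g f ∧ x = g ^ 12}

/-! Each property is a countable conjunction of conditions on fixed numbers, so it suffices that
each condition is open and dense. Openness: equations between words are clopen, and existential
quantifiers range over `ℕ`. Density: if a torsion-free overgroup has witnesses,
`exists_mem_nhds_enumeration` puts them into groups arbitrarily near the given one. Roots come from
an HNN extension conjugating `x` to `x ^ m`. The other witnesses lie in the wreath product of a free
group by `G`, as functions supported on a cyclic subgroup. Two conditions then give the
centralizers. If `k ∉ ⟨f⟩`, some `g` commutes with `f` while `g ^ 12` does not commute with `k`. If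
`h ∉ ⟨g⟩`, suitable `a`, `b` exist in the centralizer of `g`. As `[f, h] ≠ 1` forces `h ∉ ⟨g⟩`, this
`g` is algebraically disjoint from `f`, so `k` does not centralize `S_f`. -/

namespace HNNExtension

/-! ### Torsion in HNN extensions -/

open NormalWord

variable {G : Type*} [Group G] {A B : Subgroup G} {φ : A ≃* B}

/-- The product of the letters `t ^ u * g` over a list of pairs `(u, g)`. -/
def wordProd (φ : A ≃* B) (l : List (ℤˣ × G)) : HNNExtension G A B φ :=
  (l.map fun x => t ^ (x.1 : ℤ) * of x.2).prod

@[simp]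
theorem wordProd_nil : wordProd φ [] = 1 := rfl

@[simp]
theorem wordProd_cons (a : ℤˣ × G) (l : List (ℤˣ × G)) :
    wordProd φ (a :: l) = t ^ (a.1 : ℤ) * of a.2 * wordProd φ l := by
  simp [wordProd]

@[simp]
theorem wordProd_append (l l' : List (ℤˣ × G)) :
    wordProd φ (l ++ l') = wordProd φ l * wordProd φ l' := by
  simp [wordProd]

theorem wordProd_flatten_replicate (n : ℕ) (l : List (ℤˣ × G)) :
    wordProd φ (List.replicate n l).flatten = wordProd φ l ^ n := by
  induction n with
  | zero => simp
  | succ n ih => simp [List.replicate_succ, ih, pow_succ']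

theorem exists_wordProd (x : HNNExtension G A B φ) :
    ∃ (g : G) (l : List (ℤˣ × G)), x = of g * wordProd φ l := by
  obtain ⟨d⟩ := TransversalPair.nonempty G A B
  refine ⟨((equiv φ d) x).head, ((equiv φ d) x).toList, ?_⟩
  exact ((equiv φ d).symm_apply_apply x).symm

theorem isConj_wordProd_append_comm (l l' : List (ℤˣ × G)) :
    IsConj (wordProd φ (l ++ l')) (wordProd φ (l' ++ l)) := by
  rw [isConj_iff]
  exact ⟨(wordProd φ l)⁻¹, by simp⟩

theorem zpow_units_mul_of (u : ℤˣ) (g : G) (hg : g ∈ toSubgroup A B u) :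
    ∃ k : G, (t ^ (u : ℤ) * of g * t ^ ((-u : ℤˣ) : ℤ) : HNNExtension G A B φ) = of k := by
  rcases Int.units_eq_one_or u with rfl | rfl
  · exact ⟨φ ⟨g, hg⟩, by simp [equiv_eq_conj]⟩
  · exact ⟨φ.symm ⟨g, hg⟩, by simp [equiv_symm_eq_conj]⟩

/-- Two successive letters `t ^ u * g`, `t ^ v * h` do not admit a reduction. -/
def NoPinch (A B : Subgroup G) (a b : ℤˣ × G) : Prop :=
  a.2 ∈ toSubgroup A B a.1 → a.1 = b.1

/-- A pinch in `l ++ l` lies inside `l` or at the seam; a rotation brings it to the front. A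
one-letter word has no pinch at its seam. -/
theorem exists_pinch_of_not_cyclicallyReduced (l : List (ℤˣ × G))
    (h : ¬ (l ++ l).IsChain (NoPinch A B)) :
    ∃ a b l₁ l₂, l = l₁ ++ l₂ ∧ (∃ r, l₂ ++ l₁ = a :: b :: r) ∧ ¬ NoPinch A B a b := by
  by_cases hl : l.IsChain (NoPinch A B)
  · rw [List.isChain_append] at h
    simp only [hl, true_and, not_forall] at h
    obtain ⟨x, hx, y, hy, hxy⟩ := h
    cases l with
    | nil => simp at hx
    | cons z l =>
      obtain rfl : z = y := by simpa using hy
      rcases List.eq_nil_or_concat l with rfl | ⟨m, w, rfl⟩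
      · obtain rfl : z = x := by simpa using hx
        exact absurd (fun _ => rfl) hxy
      · obtain rfl : w = x := by
          simpa [List.getLast?_cons, List.getLast?_append] using hx
        exact ⟨w, z, z :: m, [w], by simp, ⟨m, by simp⟩, hxy⟩
  · rw [List.isChain_iff_forall_rel_of_append_cons_cons] at hl
    push Not at hl
    obtain ⟨a, b, l₁, l₂, rfl, hab⟩ := hl
    exact ⟨a, b, l₁, a :: b :: l₂, rfl, ⟨l₂ ++ l₁, by simp⟩, hab⟩

theorem exists_isConj_of_mul_wordProd (k : G) (l : List (ℤˣ × G)) :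
    (∃ g : G, IsConj (of k * wordProd φ l) (of g)) ∨
      ∃ l' : List (ℤˣ × G), l'.length = l.length ∧
        IsConj (of k * wordProd φ l) (wordProd φ l') := by
  rcases List.eq_nil_or_concat l with rfl | ⟨m, ⟨v, c⟩, rfl⟩
  · exact Or.inl ⟨k, by rw [wordProd_nil, mul_one]⟩
  · refine Or.inr ⟨m ++ [(v, c * k)], by simp, ?_⟩
    rw [isConj_iff]
    exact ⟨(of k)⁻¹, by simp [mul_assoc]⟩

/-- Rotating a pinch to the front and collapsing it removes two letters up to conjugacy, so
induction on length applies. -/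
theorem exists_isConj_of_or_cyclicallyReduced (n : ℕ) (l : List (ℤˣ × G)) (hn : l.length ≤ n) :
    (∃ g : G, IsConj (wordProd φ l) (of g)) ∨
      ∃ l' : List (ℤˣ × G), l' ≠ [] ∧ (l' ++ l').IsChain (NoPinch A B) ∧
        IsConj (wordProd φ l) (wordProd φ l') := by
  induction n generalizing l with
  | zero =>
    obtain rfl : l = [] := by simpa using hn
    exact Or.inl ⟨1, by simp⟩
  | succ n ih =>
    by_cases hl : (l ++ l).IsChain (NoPinch A B)
    · by_cases h0 : l = []
      · exact Or.inl ⟨1, by simp [h0]⟩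
      · exact Or.inr ⟨l, h0, hl, IsConj.refl _⟩
    obtain ⟨⟨u, g⟩, ⟨v, g'⟩, l₁, l₂, rfl, ⟨r, hr⟩, hab⟩ :=
      exists_pinch_of_not_cyclicallyReduced l hl
    have hconj := isConj_wordProd_append_comm (φ := φ) l₁ l₂
    have hlen : r.length + 2 ≤ n + 1 := by
      have := congrArg List.length hr
      simp only [List.length_append, List.length_cons] at this hn
      omega
    simp only [NoPinch, Classical.not_imp] at hab
    obtain ⟨hg, huv⟩ := hab
    obtain rfl : v = -u := by
      rcases Int.units_eq_one_or u with rfl | rfl <;>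
        rcases Int.units_eq_one_or v with rfl | rfl <;> simp_all
    obtain ⟨k, hk⟩ := zpow_units_mul_of (φ := φ) u g hg
    have hword : wordProd φ (l₂ ++ l₁) = of (k * g') * wordProd φ r := by
      rw [hr, wordProd_cons, wordProd_cons, map_mul, ← hk]
      simp only [mul_assoc]
    rw [hword] at hconj
    rcases exists_isConj_of_mul_wordProd (φ := φ) (k * g') r with ⟨c, hc⟩ | ⟨l', hl', hc⟩
    · exact Or.inl ⟨c, hconj.trans hc⟩
    · rcases ih l' (by omega) with ⟨c, hc'⟩ | ⟨l'', h0, hch, hc'⟩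
      · exact Or.inl ⟨c, hconj.trans (hc.trans hc')⟩
      · exact Or.inr ⟨l'', h0, hch, hconj.trans (hc.trans hc')⟩

/-- All seams in a power of `l` look like the one in `l ++ l`, so the power is a nonempty reduced
word and Britton's lemma applies. -/
theorem wordProd_pow_ne_one {l : List (ℤˣ × G)} (h0 : l ≠ [])
    (hl : (l ++ l).IsChain (NoPinch A B)) {n : ℕ} (hn : 0 < n) : wordProd φ l ^ n ≠ 1 := by
  intro h
  have hchain : (List.replicate n l).flatten.IsChain (NoPinch A B) := by
    rw [List.isChain_append] at hl
    rw [List.isChain_flatten (by simp [List.mem_replicate, Ne.symm h0])]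
    refine ⟨fun m hm => ?_, List.isChain_replicate_of_rel n hl.2.2⟩
    rw [List.eq_of_mem_replicate hm]
    exact hl.1
  have := ReducedWord.toList_eq_nil_of_mem_of_range φ ⟨1, (List.replicate n l).flatten, hchain⟩
    ⟨1, by
      rw [map_one, ← h, ← wordProd_flatten_replicate]
      simp [ReducedWord.prod, wordProd]⟩
  simp only [List.flatten_eq_nil_iff, List.mem_replicate] at this
  exact h0 (this l ⟨hn.ne', rfl⟩)

/-- An element of finite order in an HNN extension is conjugate into the base group. -/
theorem exists_isConj_of_of_isOfFinOrder {x : HNNExtension G A B φ} (hx : IsOfFinOrder x) :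
    ∃ g : G, IsConj x (of g) := by
  obtain ⟨k, l, rfl⟩ := exists_wordProd x
  rcases exists_isConj_of_mul_wordProd (φ := φ) k l with h | ⟨l', -, hc⟩
  · exact h
  rcases exists_isConj_of_or_cyclicallyReduced (φ := φ) _ l' le_rfl with ⟨g, hg⟩ | ⟨m, h0, hm, hc'⟩
  · exact ⟨g, hc.trans hg⟩
  · obtain ⟨n, hn, hpow⟩ := isOfFinOrder_iff_pow_eq_one.1 hx
    obtain ⟨c, hcc⟩ := isConj_iff.1 (hc.trans hc')
    refine absurd ?_ (wordProd_pow_ne_one (φ := φ) h0 hm hn)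
    rw [← hcc, conj_pow, hpow]
    simp

theorem not_isOfFinOrder (hG : ∀ g : G, g ≠ 1 → ¬ IsOfFinOrder g)
    (x : HNNExtension G A B φ) (hx1 : x ≠ 1) : ¬ IsOfFinOrder x := by
  intro hx
  obtain ⟨g, hg⟩ := exists_isConj_of_of_isOfFinOrder hx
  obtain ⟨c, hc⟩ := isConj_iff.1 hg
  have hgfin : IsOfFinOrder g := by
    rw [← (of_injective φ).isOfFinOrder_iff, ← hc]
    obtain ⟨n, hn, hpow⟩ := isOfFinOrder_iff_pow_eq_one.1 hx
    exact isOfFinOrder_iff_pow_eq_one.2 ⟨n, hn, by rw [conj_pow, hpow]; simp⟩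
  have : g = 1 := by_contra fun h => hG g h hgfin
  subst this
  refine hx1 ?_
  simpa [mul_inv_eq_one] using hc

end HNNExtension

/-- Every element of a torsion-free group has roots of all orders in a torsion-free overgroup. -/
theorem exists_torsionFree_overgroup_pow_eq {G : Type} [Group G]
    (hG : ∀ x : G, x ≠ 1 → ¬ IsOfFinOrder x) (x : G) {m : ℕ} (hm : 1 ≤ m) :
    ∃ (H : Type) (_ : Group H) (i : G →* H), (∀ y : H, y ≠ 1 → ¬ IsOfFinOrder y) ∧
      Function.Injective i ∧ ∃ y : H, y ^ m = i x := by
  by_cases hx : x = 1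
  · exact ⟨G, inferInstance, MonoidHom.id G, hG, Function.injective_id, 1, by simp [hx]⟩
  have hinf : ∀ y : G, y ≠ 1 → Function.Injective (zpowersHom G y) := fun y hy => by
    intro a b hab
    exact Multiplicative.toAdd.injective
      (injective_zpow_iff_not_isOfFinOrder.2 (hG y hy) (by simpa using hab))
  have hxm : x ^ m ≠ 1 := fun h => hG x hx (isOfFinOrder_iff_pow_eq_one.2 ⟨m, hm, h⟩)
  -- Both cyclic groups are infinite, so `x ↦ x ^ m` is an isomorphism. Then `t x t⁻¹ = x ^ m`, and
  -- `t⁻¹ x t` is an `m`-th root of `x`.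
  let e := (MonoidHom.ofInjective (hinf x hx)).symm.trans (MonoidHom.ofInjective (hinf _ hxm))
  have he : ∀ h, (e ⟨x, h⟩ : G) = x ^ m := by
    intro h
    have : (⟨x, h⟩ : (zpowersHom G x).range) =
        MonoidHom.ofInjective (hinf x hx) (Multiplicative.ofAdd 1) := by
      ext; simp [MonoidHom.ofInjective_apply]
    simp [e, this, MonoidHom.ofInjective_apply]
  have hmem : x ∈ (zpowersHom G x).range := ⟨Multiplicative.ofAdd 1, by simp⟩
  refine ⟨HNNExtension G _ _ e, inferInstance, HNNExtension.of,
    HNNExtension.not_isOfFinOrder hG, HNNExtension.of_injective _,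
    HNNExtension.t⁻¹ * HNNExtension.of x * HNNExtension.t, ?_⟩
  have h1 := HNNExtension.equiv_eq_conj (φ := e) ⟨x, hmem⟩
  rw [he] at h1
  have h2 : (HNNExtension.t⁻¹ * HNNExtension.of x * HNNExtension.t : HNNExtension G _ _ e) ^ m
      = HNNExtension.t⁻¹ * HNNExtension.of x ^ m * HNNExtension.t := by
    simpa using conj_pow (a := (HNNExtension.t⁻¹ : HNNExtension G _ _ e))
      (b := HNNExtension.of x) (i := m)
  rw [h2, ← map_pow, h1]
  simp [mul_assoc]

/-! ### Wreath products and commuting witnesses -/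

namespace RegularWreathProduct

variable {D Q : Type*} [Group D] [Group Q]

theorem not_isOfFinOrder (hD : ∀ d : D, d ≠ 1 → ¬ IsOfFinOrder d)
    (hQ : ∀ q : Q, q ≠ 1 → ¬ IsOfFinOrder q) (w : D ≀ᵣ Q) (hw : w ≠ 1) : ¬ IsOfFinOrder w := by
  intro h
  have hr : w.right = 1 := by_contra fun hne => hQ _ hne (rightHom.isOfFinOrder h)
  obtain ⟨n, hn, hpow⟩ := isOfFinOrder_iff_pow_eq_one.1 h
  have key : ∀ k : ℕ, (w ^ k).left = w.left ^ k := by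
    intro k
    induction k with
    | zero => simp
    | succ k ih => rw [pow_succ', mul_left, ih, hr, pow_succ']; simp; rfl
  refine hw (RegularWreathProduct.ext (funext fun q => ?_) hr)
  by_contra hne
  refine hD _ hne (isOfFinOrder_iff_pow_eq_one.2 ⟨n, hn, ?_⟩)
  have := congrFun (key n) q
  rw [hpow] at this
  simpa using this.symm

theorem inl_injective : Function.Injective (inl : Q →* D ≀ᵣ Q) := fun a b h => by
  simpa using congrArg RegularWreathProduct.right h

open Classical in
/-- The element of the base group with value `d` on the subgroup `K` and trivial elsewhere. -/
noncomputable def indicator (K : Subgroup Q) : D →* D ≀ᵣ Q where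
  toFun d := ⟨fun q => if q ∈ K then d else 1, 1⟩
  map_one' := by ext <;> simp
  map_mul' a b := by
    ext q
    · by_cases h : q ∈ K <;> simp [h]
    · simp

@[simp]
theorem indicator_right (K : Subgroup Q) (d : D) : (indicator K d : D ≀ᵣ Q).right = 1 := rfl

open Classical in
theorem indicator_left (K : Subgroup Q) (d : D) :
    (indicator K d : D ≀ᵣ Q).left = fun q => if q ∈ K then d else 1 := rfl

theorem indicator_commute_inl (K : Subgroup Q) (d : D) {g : Q} (hg : g ∈ K) :
    indicator K d * inl g = inl g * indicator K d := by
  ext q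
  · have h1 : g⁻¹ * q ∈ K ↔ q ∈ K := K.mul_mem_cancel_left (K.inv_mem hg)
    by_cases hq : q ∈ K
    · simp [indicator_left, hq, h1.2 hq]
    · simp [indicator_left, hq, mt h1.1 hq]
  · simp

theorem indicator_mul_inl_ne (K : Subgroup Q) {d : D} (hd : d ≠ 1) {h : Q} (hh : h ∉ K) :
    indicator K d * inl h ≠ inl h * indicator K d := by
  intro heq
  have := congrFun (congrArg left heq) 1
  simp [indicator_left, K.one_mem, hh, hd] at this

/-- The inner commutator is `b⁻¹` on `K` and `b` on `h⁻¹K`, which is disjoint from `K`. The function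
of `a` lives on `K` and sees only the first part. -/
theorem groupComm_indicator (K : Subgroup Q) (a b : D) {h : Q} (hh : h ∉ K) :
    groupComm (indicator K a) (groupComm (indicator K b) (inl h)) =
      indicator K (groupComm a b⁻¹) := by
  ext q
  · by_cases hq : q ∈ K
    · have h1 : h * q ∉ K := by rwa [K.mul_mem_cancel_right hq]
      simp [groupComm, indicator_left, hq, h1]
    · by_cases h1 : h * q ∈ K <;> simp [groupComm, indicator_left, hq, h1]
  · simp [groupComm]

end RegularWreathProduct

theorem FreeGroup.not_isOfFinOrder {α : Type*} (x : FreeGroup α) (hx : x ≠ 1) :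
    ¬ IsOfFinOrder x := not_isOfFinOrder_of_isMulTorsionFree hx

/-- An element outside `⟨f⟩` is not centralized by the twelfth powers of the elements commuting
with `f`, in a suitable torsion-free overgroup. -/
theorem exists_torsionFree_overgroup_not_commute {G : Type} [Group G]
    (hG : ∀ x : G, x ≠ 1 → ¬ IsOfFinOrder x) {f k : G} (hk : k ∉ Subgroup.zpowers f) :
    ∃ (H : Type) (_ : Group H) (i : G →* H), (∀ y : H, y ≠ 1 → ¬ IsOfFinOrder y) ∧
      Function.Injective i ∧ ∃ g : H, g * i f = i f * g ∧ g ^ 12 * i k ≠ i k * g ^ 12 := by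
  refine ⟨FreeGroup Bool ≀ᵣ G, inferInstance, RegularWreathProduct.inl,
    RegularWreathProduct.not_isOfFinOrder FreeGroup.not_isOfFinOrder hG,
    RegularWreathProduct.inl_injective,
    RegularWreathProduct.indicator (Subgroup.zpowers f) (FreeGroup.of true),
    RegularWreathProduct.indicator_commute_inl _ _ (Subgroup.mem_zpowers f), ?_⟩
  rw [← map_pow]
  refine RegularWreathProduct.indicator_mul_inl_ne _ (fun h => ?_) hk
  exact FreeGroup.not_isOfFinOrder (FreeGroup.of true) (FreeGroup.of_ne_one true)
    (isOfFinOrder_iff_pow_eq_one.2 ⟨12, by norm_num, h⟩)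

/-- For `h` outside `⟨g⟩` there are `a`, `b` commuting with `g` as in the definition of algebraic
disjointness, in a suitable torsion-free overgroup. -/
theorem exists_torsionFree_overgroup_groupComm {G : Type} [Group G]
    (hG : ∀ x : G, x ≠ 1 → ¬ IsOfFinOrder x) {g h : G} (hh : h ∉ Subgroup.zpowers g) :
    ∃ (H : Type) (_ : Group H) (i : G →* H), (∀ y : H, y ≠ 1 → ¬ IsOfFinOrder y) ∧
      Function.Injective i ∧ ∃ a b : H, a * i g = i g * a ∧ b * i g = i g * b ∧
        groupComm a (groupComm b (i h)) ≠ 1 ∧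
        groupComm a (groupComm b (i h)) * i g = i g * groupComm a (groupComm b (i h)) := by
  have hg := Subgroup.mem_zpowers g
  refine ⟨FreeGroup Bool ≀ᵣ G, inferInstance, RegularWreathProduct.inl,
    RegularWreathProduct.not_isOfFinOrder FreeGroup.not_isOfFinOrder hG,
    RegularWreathProduct.inl_injective,
    RegularWreathProduct.indicator (Subgroup.zpowers g) (FreeGroup.of true),
    RegularWreathProduct.indicator (Subgroup.zpowers g) (FreeGroup.of false),
    RegularWreathProduct.indicator_commute_inl _ _ hg,
    RegularWreathProduct.indicator_commute_inl _ _ hg, ?_, ?_⟩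
  · rw [RegularWreathProduct.groupComm_indicator _ _ _ hh]
    intro h1
    have h2 := congrFun (congrArg RegularWreathProduct.left h1) 1
    simp only [RegularWreathProduct.indicator_left, Subgroup.one_mem, if_true,
      RegularWreathProduct.one_left, Pi.one_apply] at h2
    revert h2
    decide
  · rw [RegularWreathProduct.groupComm_indicator _ _ _ hh]
    exact RegularWreathProduct.indicator_commute_inl _ _ hg

/-! ### Approximation by enumerated overgroups -/

open Filter Topology

namespace TorsionFreeEnumeratedGroup

/-- The enumerated group obtained by transporting a group structure along a bijection with `ℕ`. -/
def _root_.EnumeratedGroup.ofEquiv {K : Type*} [Group K] (e : ℕ ≃ K) : EnumeratedGroup :=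
  ⟨(fun p => e.symm (e p.1 * e p.2), fun x => e.symm (e x)⁻¹, e.symm 1),
    { mul_assoc := fun x y z => by simp [mul_assoc]
      one_mul := fun x => by simp
      mul_one := fun x => by simp
      inv_mul_cancel := fun x => by simp
      mul_inv_cancel := fun x => by simp }⟩

/-- The bijection along which a group structure was transported, as an isomorphism. -/
def _root_.EnumeratedGroup.ofEquivMulEquiv {K : Type*} [Group K] (e : ℕ ≃ K) :
    (EnumeratedGroup.ofEquiv e).Carrier ≃* K where
  toEquiv := e
  map_mul' x y := e.apply_symm_apply (e x * e y)

/-- A number, viewed as an element of an enumerated torsion-free group. -/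
def elem (G : TorsionFreeEnumeratedGroup) (n : ℕ) : G.1.Carrier := n

/-- A countable group generated by an embedded enumerated group and finitely many elements can be
enumerated so that finitely many numbers keep their meaning. -/
theorem exists_enumeration (G : TorsionFreeEnumeratedGroup) {H : Type} [Group H]
    (hH : ∀ y : H, y ≠ 1 → ¬ IsOfFinOrder y) (i : G.1.Carrier →* H) (hi : Function.Injective i)
    (S : Set H) (hS : S.Finite) (F : Finset ℕ) :
    ∃ (G' : TorsionFreeEnumeratedGroup) (j : G'.1.Carrier →* H), Function.Injective j ∧
      (∀ n ∈ F, j (elem G' n) = i (elem G n)) ∧ S ⊆ Set.range j := by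
  have : Finite S := hS
  have : Countable G.1.Carrier := inferInstanceAs (Countable ℕ)
  have : Infinite G.1.Carrier := inferInstanceAs (Infinite ℕ)
  let p : FreeGroup (G.1.Carrier ⊕ S) →* H := FreeGroup.lift (Sum.elim i Subtype.val)
  let K : Subgroup H := p.range
  have hK : Countable K := p.rangeRestrict_surjective.countable
  let i' : G.1.Carrier → K := fun x => ⟨i x, FreeGroup.of (Sum.inl x), by simp [p]⟩
  have hi' : Function.Injective i' := fun x y hxy => hi (congrArg Subtype.val hxy)
  have : Infinite K := Infinite.of_injective i' hi'
  let f : (F : Set ℕ) ↪ K := ⟨fun n => i' n.1, fun x y hxy => Subtype.ext (hi' hxy)⟩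
  have hcF : Infinite ↥((F : Set ℕ)ᶜ) := F.finite_toSet.infinite_compl.to_subtype
  have hcK : Infinite ↥((Set.range f)ᶜ) := (Set.finite_range f).infinite_compl.to_subtype
  -- The complements of `F` and of its image are both countably infinite, so the prescribed values
  -- extend to a bijection.
  obtain ⟨e, he⟩ := Cardinal.extend_function f (nonempty_equiv_of_countable)
  let j : (EnumeratedGroup.ofEquiv e).Carrier →* H :=
    K.subtype.comp (EnumeratedGroup.ofEquivMulEquiv e).toMonoidHom
  have hj : Function.Injective j :=
    K.subtype_injective.comp (EnumeratedGroup.ofEquivMulEquiv e).injective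
  refine ⟨⟨EnumeratedGroup.ofEquiv e, fun x hx hfin =>
    hH (j x) (fun h => hx (hj (h.trans (map_one j).symm))) (j.isOfFinOrder hfin)⟩, j, hj, ?_, ?_⟩
  · intro n hn
    exact congrArg Subtype.val (he ⟨n, hn⟩)
  · intro s hs
    refine ⟨e.symm ⟨s, FreeGroup.of (Sum.inr ⟨s, hs⟩), by simp [p]⟩, ?_⟩
    exact congrArg Subtype.val (e.apply_symm_apply _)

/-- Every torsion-free overgroup of an enumerated group is realized, up to finitely many elements,
by enumerated groups arbitrarily close to the given one. -/
theorem exists_mem_nhds_enumeration (G : TorsionFreeEnumeratedGroup) {H : Type} [Group H]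
    (hH : ∀ y : H, y ≠ 1 → ¬ IsOfFinOrder y) (i : G.1.Carrier →* H) (hi : Function.Injective i)
    (S : Set H) (hS : S.Finite) (F : Finset ℕ) {U : Set TorsionFreeEnumeratedGroup}
    (hU : U ∈ 𝓝 G) :
    ∃ G' ∈ U, ∃ j : G'.1.Carrier →* H, Function.Injective j ∧
      (∀ n ∈ F, j (elem G' n) = i (elem G n)) ∧ S ⊆ Set.range j := by
  choose E j hj hjF hjS using fun F => exists_enumeration G hH i hi S hS F
  have hmem : ∀ n : ℕ, ∀ᶠ F : Finset ℕ in atTop, n ∈ F := fun n => by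
    filter_upwards [eventually_ge_atTop {n}] with F hF
    exact hF (Finset.mem_singleton_self n)
  -- Each table entry is eventually constant: once `F` contains its arguments and its value,
  -- injectivity of `j F` fixes it.
  have hlim : Tendsto E atTop (𝓝 G) := by
    rw [tendsto_subtype_rng, tendsto_subtype_rng]
    refine Tendsto.prodMk_nhds (tendsto_pi_nhds.2 ?_)
      (Tendsto.prodMk_nhds (tendsto_pi_nhds.2 ?_) ?_)
    · rintro ⟨x, y⟩
      refine tendsto_nhds_of_eventually_eq ?_
      filter_upwards [hmem x, hmem y, hmem (G.1.1.1 (x, y))] with F h1 h2 h3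
      refine hj F ?_
      have h4 : j F (elem (E F) ((E F).1.1.1 (x, y))) = j F (elem _ x) * j F (elem _ y) :=
        map_mul (j F) (elem _ x) (elem _ y)
      have h5 : i (elem G (G.1.1.1 (x, y))) = i (elem _ x) * i (elem _ y) :=
        map_mul i (elem _ x) (elem _ y)
      exact h4.trans (by rw [hjF F x h1, hjF F y h2, ← h5, ← hjF F _ h3]; rfl)
    · intro x
      refine tendsto_nhds_of_eventually_eq ?_
      filter_upwards [hmem x, hmem (G.1.1.2.1 x)] with F h1 h3
      refine hj F ?_
      have h4 : j F (elem (E F) ((E F).1.1.2.1 x)) = (j F (elem _ x))⁻¹ :=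
        map_inv (j F) (elem _ x)
      have h5 : i (elem G (G.1.1.2.1 x)) = (i (elem _ x))⁻¹ := map_inv i (elem _ x)
      exact h4.trans (by rw [hjF F x h1, ← h5, ← hjF F _ h3]; rfl)
    · refine tendsto_nhds_of_eventually_eq ?_
      filter_upwards [hmem G.1.1.2.2] with F h3
      refine hj F ?_
      have h4 : j F (elem (E F) (E F).1.1.2.2) = 1 := map_one (j F)
      have h5 : i (elem G G.1.1.2.2) = 1 := map_one i
      exact h4.trans (by rw [← h5, ← hjF F _ h3]; rfl)
  obtain ⟨F', hF', hFF'⟩ := ((hlim.eventually hU).and (eventually_ge_atTop F)).exists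
  exact ⟨E F', hF', j F', hj F', fun n hn => hjF F' n (hFF' hn), hjS F'⟩

/-! ### Continuity of word maps and openness -/

theorem continuous_eval_apply {X : Type*} [TopologicalSpace X] {u : X → ℕ → ℕ} {a : X → ℕ}
    (hu : ∀ n, Continuous fun x => u x n) (ha : Continuous a) : Continuous fun x => u x (a x) := by
  rw [continuous_discrete_rng] at ha
  rw [continuous_iff_continuousAt]
  intro x
  refine (hu (a x)).continuousAt.congr ?_
  filter_upwards [(ha (a x)).mem_nhds rfl] with y hy
  rw [show a y = a x from hy]

theorem continuous_mul {a b : ∀ G : TorsionFreeEnumeratedGroup, G.1.Carrier}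
    (ha : Continuous (Y := ℕ) a) (hb : Continuous (Y := ℕ) b) :
    Continuous (Y := ℕ) fun G => (a G * b G : G.1.Carrier) :=
  continuous_eval_apply (u := fun G n => G.1.1.1 (n, b G)) (fun n =>
    continuous_eval_apply (u := fun G m => G.1.1.1 (n, m)) (fun m => by fun_prop) hb) ha

theorem continuous_inv {a : ∀ G : TorsionFreeEnumeratedGroup, G.1.Carrier}
    (ha : Continuous (Y := ℕ) a) : Continuous (Y := ℕ) fun G => ((a G)⁻¹ : G.1.Carrier) :=
  continuous_eval_apply (u := fun G n => G.1.1.2.1 n) (fun n => by fun_prop) ha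

theorem continuous_one :
    Continuous (Y := ℕ) fun G : TorsionFreeEnumeratedGroup => (1 : G.1.Carrier) :=
  show Continuous fun G : TorsionFreeEnumeratedGroup => G.1.1.2.2 by fun_prop

theorem continuous_pow {a : ∀ G : TorsionFreeEnumeratedGroup, G.1.Carrier}
    (ha : Continuous (Y := ℕ) a) (n : ℕ) : Continuous (Y := ℕ) fun G => (a G ^ n : G.1.Carrier) := by
  induction n with
  | zero => simpa only [pow_zero] using continuous_one
  | succ n ih => simpa only [pow_succ] using continuous_mul ih ha

theorem continuous_zpow {a : ∀ G : TorsionFreeEnumeratedGroup, G.1.Carrier}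
    (ha : Continuous (Y := ℕ) a) (n : ℤ) : Continuous (Y := ℕ) fun G => (a G ^ n : G.1.Carrier) := by
  cases n with
  | ofNat n => simpa only [Int.ofNat_eq_natCast, zpow_natCast] using continuous_pow ha n
  | negSucc n => simpa only [zpow_negSucc] using continuous_inv (continuous_pow ha _)

theorem continuous_groupComm {a b : ∀ G : TorsionFreeEnumeratedGroup, G.1.Carrier}
    (ha : Continuous (Y := ℕ) a) (hb : Continuous (Y := ℕ) b) :
    Continuous (Y := ℕ) fun G => (groupComm (a G) (b G) : G.1.Carrier) :=
  continuous_mul (continuous_mul (continuous_mul (continuous_inv ha) (continuous_inv hb)) ha) hb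

theorem isClopen_setOf_eq {a b : ∀ G : TorsionFreeEnumeratedGroup, G.1.Carrier}
    (ha : Continuous (Y := ℕ) a) (hb : Continuous (Y := ℕ) b) : IsClopen {G | a G = b G} :=
  (isClopen_discrete {p : ℕ × ℕ | p.1 = p.2}).preimage (ha.prodMk hb)

theorem continuous_elem (n : ℕ) : Continuous (Y := ℕ) fun G => elem G n :=
  continuous_const

theorem isOpen_setOf_exists {P : ∀ G : TorsionFreeEnumeratedGroup, G.1.Carrier → Prop}
    (hP : ∀ n, IsOpen {G | P G (elem G n)}) : IsOpen {G | ∃ x, P G x} := by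
  convert isOpen_iUnion hP using 1
  ext G
  rw [Set.mem_iUnion]
  rfl

theorem isOpen_setOf_mem_zpowers (f k : ℕ) :
    IsOpen {G | elem G k ∈ Subgroup.zpowers (elem G f)} := by
  convert isOpen_iUnion fun n : ℤ => (isClopen_setOf_eq
    (continuous_zpow (continuous_elem f) n) (continuous_elem k)).isOpen using 1
  ext G
  rw [Set.mem_iUnion]
  exact Subgroup.mem_zpowers_iff

/-! ### Generic existence of witnesses -/

theorem eventually_residual_exists_not_commute (f k : ℕ) :
    ∀ᶠ G in residual TorsionFreeEnumeratedGroup,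
      elem G k ∈ Subgroup.zpowers (elem G f) ∨
        ∃ g : G.1.Carrier, g * elem G f = elem G f * g ∧ g ^ 12 * elem G k ≠ elem G k * g ^ 12 := by
  refine residual_of_dense_open ?_ fun G => mem_closure_iff_nhds.2 fun U hU => ?_
  · refine (isOpen_setOf_mem_zpowers f k).union (isOpen_setOf_exists fun g => ?_)
    have hc := continuous_elem
    exact (isClopen_setOf_eq (continuous_mul (hc g) (hc f))
      (continuous_mul (hc f) (hc g))).isOpen.inter
        (isClopen_setOf_eq (continuous_mul (continuous_pow (hc g) 12) (hc k))
          (continuous_mul (hc k) (continuous_pow (hc g) 12))).compl.isOpen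
  · by_cases hk : elem G k ∈ Subgroup.zpowers (elem G f)
    · exact ⟨G, mem_of_mem_nhds hU, Or.inl hk⟩
    obtain ⟨H, _, i, hH, hi, g, h1, h2⟩ := exists_torsionFree_overgroup_not_commute G.2 hk
    obtain ⟨G', hG', j, hj, hjF, hjS⟩ :=
      exists_mem_nhds_enumeration G hH i hi {g} (Set.finite_singleton g) {f, k} hU
    obtain ⟨g', rfl⟩ := hjS rfl
    rw [← hjF f (by simp)] at h1
    rw [← hjF k (by simp)] at h2
    refine ⟨G', hG', Or.inr ⟨g', hj ?_, fun h => h2 ?_⟩⟩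
    · rw [map_mul, map_mul, h1]
    · rw [← map_pow, ← map_mul, ← map_mul, h]

theorem eventually_residual_exists_groupComm (g h : ℕ) :
    ∀ᶠ G in residual TorsionFreeEnumeratedGroup,
      elem G h ∈ Subgroup.zpowers (elem G g) ∨
        ∃ a b : G.1.Carrier, a * elem G g = elem G g * a ∧ b * elem G g = elem G g * b ∧
          groupComm a (groupComm b (elem G h)) ≠ 1 ∧
          groupComm a (groupComm b (elem G h)) * elem G g =
            elem G g * groupComm a (groupComm b (elem G h)) := by
  refine residual_of_dense_open ?_ fun G => mem_closure_iff_nhds.2 fun U hU => ?_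
  · refine (isOpen_setOf_mem_zpowers g h).union
      (isOpen_setOf_exists fun a => isOpen_setOf_exists fun b => ?_)
    have hc := continuous_elem
    have hcomm := continuous_groupComm (hc a) (continuous_groupComm (hc b) (hc h))
    exact (isClopen_setOf_eq (continuous_mul (hc a) (hc g))
      (continuous_mul (hc g) (hc a))).isOpen.inter
      ((isClopen_setOf_eq (continuous_mul (hc b) (hc g))
        (continuous_mul (hc g) (hc b))).isOpen.inter
      ((isClopen_setOf_eq hcomm continuous_one).compl.isOpen.inter
        (isClopen_setOf_eq (continuous_mul hcomm (hc g)) (continuous_mul (hc g) hcomm)).isOpen))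
  · by_cases hh : elem G h ∈ Subgroup.zpowers (elem G g)
    · exact ⟨G, mem_of_mem_nhds hU, Or.inl hh⟩
    obtain ⟨H, _, i, hH, hi, a, b, h1, h2, h3, h4⟩ :=
      exists_torsionFree_overgroup_groupComm G.2 hh
    obtain ⟨G', hG', j, hj, hjF, hjS⟩ :=
      exists_mem_nhds_enumeration G hH i hi {a, b} (Set.toFinite _) {g, h} hU
    obtain ⟨a', rfl⟩ := hjS (Set.mem_insert a {b})
    obtain ⟨b', rfl⟩ := hjS (Set.mem_insert_of_mem _ rfl)
    have key : groupComm (j a') (groupComm (j b') (i (elem G h))) =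
        j (groupComm a' (groupComm b' (elem G' h))) := by
      rw [← hjF h (by simp)]
      simp only [groupComm, map_mul, map_inv]
    rw [← hjF g (by simp)] at h1 h2 h4
    rw [key] at h3 h4
    refine ⟨G', hG', Or.inr ⟨a', b', hj ?_, hj ?_, fun h => h3 ?_, hj ?_⟩⟩
    · rw [map_mul, map_mul, h1]
    · rw [map_mul, map_mul, h2]
    · rw [h, map_one]
    · rw [map_mul, map_mul, h4]

theorem eventually_residual_exists_pow_eq {m : ℕ} (hm : 1 ≤ m) (x : ℕ) :
    ∀ᶠ G in residual TorsionFreeEnumeratedGroup, ∃ y : G.1.Carrier, y ^ m = elem G x := by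
  refine residual_of_dense_open ?_ fun G => mem_closure_iff_nhds.2 fun U hU => ?_
  · exact isOpen_setOf_exists fun y =>
      (isClopen_setOf_eq (continuous_pow (continuous_elem y) m) (continuous_elem x)).isOpen
  · obtain ⟨H, _, i, hH, hi, y, hy⟩ := exists_torsionFree_overgroup_pow_eq G.2 (elem G x) hm
    obtain ⟨G', hG', j, hj, hjF, hjS⟩ :=
      exists_mem_nhds_enumeration G hH i hi {y} (Set.finite_singleton y) {x} hU
    obtain ⟨y', rfl⟩ := hjS rfl
    exact ⟨G', hG', y', hj (by rw [map_pow, hy, hjF x (by simp)])⟩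

end TorsionFreeEnumeratedGroup

/-! ### Centralizers and the conclusion -/

theorem groupComm_eq_one_iff {G : Type*} [Group G] {x y : G} :
    groupComm x y = 1 ↔ x * y = y * x := by
  rw [groupComm, mul_assoc, ← mul_inv_rev, inv_mul_eq_one, eq_comm]

/-- Otherwise `h = g` may be tested; but `b` centralizes `g`, so `[b, g] = 1` and the outer
commutator is trivial. -/
theorem AlgebraicallyDisjoint.commute {G : Type*} [Group G] {g f : G}
    (h : AlgebraicallyDisjoint g f) : f * g = g * f := by
  by_contra hne
  obtain ⟨a, -, b, hb, h1, -⟩ := h g (mt groupComm_eq_one_iff.1 hne)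
  rw [Subgroup.mem_centralizer_singleton_iff] at hb
  have hbg : groupComm b g = 1 := groupComm_eq_one_iff.2 (by simpa using hb)
  exact h1 (by rw [hbg]; simp [groupComm])

theorem centralizer_rubinSet_eq_zpowers {G : Type*} [Group G]
    (h₁ : ∀ f k : G, k ∈ Subgroup.zpowers f ∨ ∃ g : G, g * f = f * g ∧ g ^ 12 * k ≠ k * g ^ 12)
    (h₂ : ∀ g h : G, h ∈ Subgroup.zpowers g ∨ ∃ a b : G, a * g = g * a ∧ b * g = g * b ∧
      groupComm a (groupComm b h) ≠ 1 ∧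
        groupComm a (groupComm b h) * g = g * groupComm a (groupComm b h)) (f : G) :
    Subgroup.centralizer (rubinSet f) = Subgroup.zpowers f := by
  refine le_antisymm (fun k hk => ?_) ?_
  · refine (h₁ f k).resolve_right ?_
    rintro ⟨g, hgf, hgk⟩
    -- It remains to see that `g` is algebraically disjoint from `f`; an `h` in `⟨g⟩` would commute
    -- with `f`.
    refine hgk (Subgroup.mem_centralizer_iff.1 hk _ ⟨g, fun h hfh => ?_, rfl⟩)
    rcases h₂ g h with hmem | ⟨a, b, ha, hb, hne, hcomm⟩
    · obtain ⟨n, rfl⟩ := Subgroup.mem_zpowers_iff.1 hmem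
      exact absurd (groupComm_eq_one_iff.2 ((Commute.zpow_left hgf n).eq.symm)) hfh
    · exact ⟨a, Subgroup.mem_centralizer_singleton_iff.2 (by simpa using ha),
        b, Subgroup.mem_centralizer_singleton_iff.2 (by simpa using hb), hne,
        Subgroup.mem_centralizer_singleton_iff.2 (by simpa using hcomm)⟩
  · rw [Subgroup.zpowers_le, Subgroup.mem_centralizer_iff]
    rintro _ ⟨g, hg, rfl⟩
    exact (Commute.pow_left hg.commute.symm 12).eq

theorem Subgroup.eq_bot_or_isCyclic_and_infinite {G : Type*} [Group G]
    (hG : ∀ x : G, x ≠ 1 → ¬ IsOfFinOrder x) {K : Subgroup G} {g : G}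
    (hK : K ≤ Subgroup.zpowers g) : K = ⊥ ∨ (IsCyclic K ∧ Infinite K) := by
  refine or_iff_not_imp_left.2 fun hne => ⟨Subgroup.isCyclic_of_le hK, ?_⟩
  obtain ⟨x, hx, hx1⟩ := K.bot_or_exists_ne_one.resolve_left hne
  have : Infinite (Subgroup.zpowers x) := by
    simpa using Set.infinite_coe_iff.2 (infinite_zpowers.2 (hG x hx1))
  exact Infinite.of_injective _ (Subgroup.inclusion_injective (Subgroup.zpowers_le.2 hx))

/-- Membership in the filter `residual X` means containing a countable intersection of dense open
sets, so `∀ᶠ G in residual X, P G` says that `P` holds on a comeager subset of `X`. -/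
theorem corollary4p3 :
    ∀ᶠ G : TorsionFreeEnumeratedGroup in residual TorsionFreeEnumeratedGroup,
      (∀ g : G.1.Carrier, g ≠ 1 →
        Subgroup.centralizer (rubinSet g) = Subgroup.zpowers g) ∧
      (∀ n : ℕ, 1 ≤ n → ∀ g : Fin n → G.1.Carrier,
        (⨅ i, Subgroup.centralizer (rubinSet (g i))) = (⨅ i, Subgroup.zpowers (g i)) ∧
        ((⨅ i, Subgroup.zpowers (g i)) = ⊥ ∨
          (IsCyclic (⨅ i, Subgroup.zpowers (g i) : Subgroup G.1.Carrier) ∧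
            Infinite (⨅ i, Subgroup.zpowers (g i) : Subgroup G.1.Carrier)))) ∧
      (∀ m : ℕ, 1 ≤ m → ∀ x : G.1.Carrier, ∃ y : G.1.Carrier, y ^ m = x) := by
  have h₁ := eventually_countable_forall.2 fun f => eventually_countable_forall.2 fun k =>
    TorsionFreeEnumeratedGroup.eventually_residual_exists_not_commute f k
  have h₂ := eventually_countable_forall.2 fun g => eventually_countable_forall.2 fun h =>
    TorsionFreeEnumeratedGroup.eventually_residual_exists_groupComm g h
  have h₃ := eventually_countable_forall.2 fun m : ℕ => eventually_countable_forall.2 fun x =>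
    eventually_imp_distrib_left.2 fun hm : 1 ≤ m =>
      TorsionFreeEnumeratedGroup.eventually_residual_exists_pow_eq hm x
  filter_upwards [h₁, h₂, h₃] with G h₁ h₂ h₃
  have hcent := centralizer_rubinSet_eq_zpowers (G := G.1.Carrier) h₁ h₂
  refine ⟨fun g _ => hcent g, fun n hn g => ⟨iInf_congr fun i => hcent (g i), ?_⟩,
    fun m hm x => h₃ m x hm⟩
  exact Subgroup.eq_bot_or_isCyclic_and_infinite G.2 (iInf_le _ (⟨0, hn⟩ : Fin n))
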